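/- Conventions. A unital Kreĭn C*-algebra is a unital complex $*$-algebra $\mathcal A$ (no norm is fixed) that admits at least one fundamental symmetry. A fundamental symmetry of $\mathcal A$ is a $*$-automorphism $\alpha:\mathcal A\to\mathcal A$ with $\alpha\circ\alpha=\mathrm{id}$ for which there is a complete submultiplicative norm $\|\cdot\|$ on $\mathcal A$ with $\|\alpha(x^*)x\|=\|x\|^2$ for all $x\in\mathcal A$. A Kreĭn space is a complex vector space $K$ with a Hermitian sesquilinear form $\langle\cdot,\cdot\rangle$ that admits a fundamental decomposition, i.e. a direct sum decomposition $K=K_+\oplus K_-$ into orthogonal subspaces such that $K_+$ with $\langle\cdot,\cdot\rangle$ and $K_-$ with $-\langle\cdot,\cdot\rangle$ are Hilbert spaces. The fundamental symmetry of $K$ associated with this decomposition is $J:x_++x_-\mapsto x_+-x_-$, and $(x,y)\mapsto\langle x,Jy\rangle$ makes $K$ a Hilbert space, whose norm topology on $K$ does not depend on the decomposition. $B(K)$ is the algebra of linear operators on $K$ that are continuous for this topology, with the operator norm topology and with involution the Kreĭn adjoint, $\langle T^*x,y\rangle=\langle x,Ty\rangle$ for all $x,y\in K$. Theorem. Every unital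 Kreĭn C*-algebra $\mathcal A$ admits at least one faithful representation on a Kreĭn space, that is, an injective unital $*$-homomorphism $\pi:\mathcal A\to B(K)$ for some Kreĭn space $K$. More precisely, for every fundamental symmetry $\alpha$ of $\mathcal A$ there are a Kreĭn space $K$, a fundamental symmetry $J$ of $K$ and a faithful unital representation $\pi:\mathcal A\to B(K)$ such that $\pi$ is a $*$-isomorphism of $\mathcal A$ onto a closed unital $*$-subalgebra of $B(K)$ and $\pi(\alpha(x))=J\,\pi(x)\,J$ for all $x\in\mathcal A$. -/

import Mathlib

open scoped ComplexConjugate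

universe u

noncomputable section

/-! ### Krein spaces -/

/-- The sesquilinear form `B` (conjugate-linear in the first, linear in the second variable) is a
positive definite Hermitian inner product for which `V` is a Hilbert space. -/
def IsHilbertForm {V : Type*} [AddCommGroup V] [Module ℂ V] (B : V →ₗ⋆[ℂ] V →ₗ[ℂ] ℂ) : Prop :=
  ∃ c : InnerProductSpace.Core ℂ V, (∀ x y, c.inner x y = B x y) ∧
    @CompleteSpace V c.toNormedAddCommGroup.toMetricSpace.toUniformSpace

/-- A fundamental decomposition `K = K₊ ⊕ K₋` of a complex vector space with a form `B`: the
summands are `B`-orthogonal, `K₊` is a Hilbert space for `B` and `K₋` is one for `-B`. -/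
structure FundamentalDecomposition {K : Type*} [AddCommGroup K] [Module ℂ K]
    (B : K →ₗ⋆[ℂ] K →ₗ[ℂ] ℂ) where
  pos : Submodule ℂ K
  neg : Submodule ℂ K
  isCompl : IsCompl pos neg
  orthogonal : ∀ x ∈ pos, ∀ y ∈ neg, B x y = 0 ∧ B y x = 0
  pos_hilbert : IsHilbertForm (B.domRestrict₁₂ pos pos)
  neg_hilbert : IsHilbertForm ((-B).domRestrict₁₂ neg neg)

namespace FundamentalDecomposition

variable {K : Type*} [AddCommGroup K] [Module ℂ K] {B : K →ₗ⋆[ℂ] K →ₗ[ℂ] ℂ}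

/-- The projection `x₊ + x₋ ↦ x₊`. -/
def projPos (D : FundamentalDecomposition B) : K →ₗ[ℂ] K := D.pos.projection D.neg D.isCompl

/-- The projection `x₊ + x₋ ↦ x₋`. -/
def projNeg (D : FundamentalDecomposition B) : K →ₗ[ℂ] K :=
  D.neg.projection D.pos D.isCompl.symm

/-- The fundamental symmetry `J : x₊ + x₋ ↦ x₊ - x₋` as a linear map. -/
def symmetryₗ (D : FundamentalDecomposition B) : K →ₗ[ℂ] K := D.projPos - D.projNeg

variable (D : FundamentalDecomposition B)

theorem projPos_mem (x : K) : D.projPos x ∈ D.pos :=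
  Submodule.projection_apply_mem D.isCompl x

theorem projNeg_mem (x : K) : D.projNeg x ∈ D.neg :=
  Submodule.projection_apply_mem D.isCompl.symm x

theorem projPos_add_projNeg (x : K) : D.projPos x + D.projNeg x = x :=
  Submodule.projection_add_projection_eq_self D.isCompl x

theorem symmetryₗ_apply (x : K) : D.symmetryₗ x = D.projPos x - D.projNeg x := rfl

theorem projPos_of_pos {x : K} (hx : x ∈ D.pos) : D.projPos x = x :=
  Submodule.projection_apply_of_mem_left D.isCompl hx

theorem projNeg_of_neg {x : K} (hx : x ∈ D.neg) : D.projNeg x = x :=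
  Submodule.projection_apply_of_mem_left D.isCompl.symm hx

theorem projPos_of_neg {x : K} (hx : x ∈ D.neg) : D.projPos x = 0 :=
  (Submodule.projection_apply_eq_zero_iff D.isCompl).2 hx

theorem projNeg_of_pos {x : K} (hx : x ∈ D.pos) : D.projNeg x = 0 :=
  (Submodule.projection_apply_eq_zero_iff D.isCompl.symm).2 hx

theorem symmetryₗ_symmetryₗ (x : K) : D.symmetryₗ (D.symmetryₗ x) = x := by
  have h := D.projPos_add_projNeg x
  simp only [symmetryₗ_apply, map_sub, D.projPos_of_pos (D.projPos_mem x),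
    D.projNeg_of_neg (D.projNeg_mem x), D.projPos_of_neg (D.projNeg_mem x),
    D.projNeg_of_pos (D.projPos_mem x), sub_zero, zero_sub, sub_neg_eq_add]
  exact h

theorem form_symmetryₗ (x y : K) :
    B x (D.symmetryₗ y) = B (D.projPos x) (D.projPos y) - B (D.projNeg x) (D.projNeg y) := by
  conv_lhs => rw [← D.projPos_add_projNeg x]
  simp [symmetryₗ_apply, (D.orthogonal _ (D.projPos_mem x) _ (D.projNeg_mem y)).1,
    (D.orthogonal _ (D.projPos_mem y) _ (D.projNeg_mem x)).2, sub_eq_add_neg]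

theorem form_symmetryₗ_left (x y : K) : B (D.symmetryₗ x) y = B x (D.symmetryₗ y) := by
  rw [form_symmetryₗ]
  conv_lhs => rw [← D.projPos_add_projNeg y]
  simp [symmetryₗ_apply, (D.orthogonal _ (D.projPos_mem x) _ (D.projNeg_mem y)).1,
    (D.orthogonal _ (D.projPos_mem y) _ (D.projNeg_mem x)).2, sub_eq_add_neg]

/-- The inner product `(x, y) ↦ ⟨x, J y⟩ = ⟨x₊, y₊⟩ - ⟨x₋, y₋⟩` on `K`. -/
@[reducible] def core : InnerProductSpace.Core ℂ K where
  inner x y := B x (D.symmetryₗ y)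
  conj_inner_symm x y := by
    obtain ⟨c, hc, -⟩ := D.pos_hilbert
    obtain ⟨d, hd, -⟩ := D.neg_hilbert
    have h1 := c.conj_inner_symm ⟨_, D.projPos_mem x⟩ ⟨_, D.projPos_mem y⟩
    have h2 := d.conj_inner_symm ⟨_, D.projNeg_mem x⟩ ⟨_, D.projNeg_mem y⟩
    simp only [hc, hd, LinearMap.domRestrict₁₂_apply, LinearMap.neg_apply, map_neg] at h1 h2
    rw [form_symmetryₗ, form_symmetryₗ, map_sub, h1, neg_injective h2]
  re_inner_nonneg x := by
    obtain ⟨c, hc, -⟩ := D.pos_hilbert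
    obtain ⟨d, hd, -⟩ := D.neg_hilbert
    have h1 := c.re_inner_nonneg ⟨_, D.projPos_mem x⟩
    have h2 := d.re_inner_nonneg ⟨_, D.projNeg_mem x⟩
    simp only [hc, hd, LinearMap.domRestrict₁₂_apply, LinearMap.neg_apply, map_neg] at h1 h2
    rw [form_symmetryₗ, map_sub]
    linarith
  add_left x y z := by simp
  smul_left x y r := by simp
  definite x hx := by
    obtain ⟨c, hc, -⟩ := D.pos_hilbert
    obtain ⟨d, hd, -⟩ := D.neg_hilbert
    have h1 := c.re_inner_nonneg ⟨_, D.projPos_mem x⟩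
    have h2 := d.re_inner_nonneg ⟨_, D.projNeg_mem x⟩
    have i1 := c.conj_inner_symm ⟨_, D.projPos_mem x⟩ ⟨_, D.projPos_mem x⟩
    have i2 := d.conj_inner_symm ⟨_, D.projNeg_mem x⟩ ⟨_, D.projNeg_mem x⟩
    have k1 := c.definite ⟨_, D.projPos_mem x⟩
    have k2 := d.definite ⟨_, D.projNeg_mem x⟩
    simp only [hc, hd, LinearMap.domRestrict₁₂_apply, LinearMap.neg_apply, map_neg] at h1 h2 i1 i2 k1 k2
    rw [form_symmetryₗ] at hx
    have hr := congrArg RCLike.re hx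
    rw [map_sub, map_zero] at hr
    have j1 : B (D.projPos x) (D.projPos x) = 0 := by
      rw [← RCLike.conj_eq_iff_re.1 i1]
      simp only [Complex.coe_algebraMap, RCLike.re_to_complex, Complex.ofReal_eq_zero] at *
      linarith
    have j2 : B (D.projNeg x) (D.projNeg x) = 0 := by
      rw [j1, zero_sub] at hx
      exact neg_eq_zero.1 hx
    have l1 : D.projPos x = 0 := congrArg Subtype.val (k1 j1)
    have l2 : D.projNeg x = 0 := congrArg Subtype.val (k2 (by rw [j2, neg_zero]))
    rw [← D.projPos_add_projNeg x, l1, l2, add_zero]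

/-- The Hilbert space `|K|_J = K₊ ⊕ (-K₋)` associated with a fundamental decomposition: the vector
space `K` with the inner product `(x, y) ↦ ⟨x, J y⟩`. -/
def HilbertSpace (_ : FundamentalDecomposition B) : Type _ := K

instance : NormedAddCommGroup D.HilbertSpace := D.core.toNormedAddCommGroup

instance : InnerProductSpace ℂ D.HilbertSpace := InnerProductSpace.ofCore D.core.toCore

instance : Inner ℂ D.HilbertSpace := InnerProductSpace.toInner

/-- The identity map from `K` to `|K|_J`. -/
def equiv : K ≃ₗ[ℂ] D.HilbertSpace where
  toFun x := x
  invFun x := x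
  map_add' _ _ := rfl
  map_smul' _ _ := rfl
  left_inv _ := rfl
  right_inv _ := rfl

theorem inner_equiv (x y : K) : inner ℂ (D.equiv x) (D.equiv y) = B x (D.symmetryₗ y) := rfl

theorem norm_equiv_sq (x : K) : ‖D.equiv x‖ ^ 2 =
    (B (D.projPos x) (D.projPos x)).re - (B (D.projNeg x) (D.projNeg x)).re := by
  rw [@norm_sq_eq_re_inner ℂ, inner_equiv, form_symmetryₗ, map_sub]
  rfl

instance : CompleteSpace D.HilbertSpace := by
  obtain ⟨c, hc, hc'⟩ := D.pos_hilbert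
  obtain ⟨d, hd, hd'⟩ := D.neg_hilbert
  let _ : NormedAddCommGroup D.pos := c.toNormedAddCommGroup
  let _ : InnerProductSpace ℂ D.pos := InnerProductSpace.ofCore c.toCore
  let _ : NormedAddCommGroup D.neg := d.toNormedAddCommGroup
  let _ : InnerProductSpace ℂ D.neg := InnerProductSpace.ofCore d.toCore
  have : CompleteSpace D.pos := hc'
  have : CompleteSpace D.neg := hd'
  have np : ∀ x : D.pos, ‖x‖ ^ 2 = (B x x).re := fun x => by
    rw [@norm_sq_eq_re_inner ℂ]; exact congrArg Complex.re (hc x x)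
  have nn : ∀ x : D.neg, ‖x‖ ^ 2 = -(B x x).re := fun x => by
    rw [@norm_sq_eq_re_inner ℂ]; exact congrArg Complex.re (hd x x)
  let e : (D.pos × D.neg) ≃ₗ[ℂ] D.HilbertSpace :=
    (Submodule.prodEquivOfIsCompl D.pos D.neg D.isCompl).trans D.equiv
  have he : ∀ p, ‖e p‖ ^ 2 = ‖p.1‖ ^ 2 + ‖p.2‖ ^ 2 := fun p => by
    have e0 : e p = D.equiv ((p.1 : K) + (p.2 : K)) := rfl
    have e1 : D.projPos ((p.1 : K) + (p.2 : K)) = p.1 := by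
      rw [map_add, D.projPos_of_pos p.1.2, D.projPos_of_neg p.2.2, add_zero]
    have e2 : D.projNeg ((p.1 : K) + (p.2 : K)) = p.2 := by
      rw [map_add, D.projNeg_of_pos p.1.2, D.projNeg_of_neg p.2.2, zero_add]
    rw [e0, norm_equiv_sq, e1, e2, np, nn, sub_eq_add_neg]
  let E : (D.pos × D.neg) ≃L[ℂ] D.HilbertSpace :=
    e.toContinuousLinearEquivOfBounds 2 1
      (fun p => by
        refine abs_le_of_sq_le_sq' ?_ (by positivity) |>.2
        have h1 : ‖p.1‖ ≤ ‖p‖ := norm_fst_le p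
        have h2 : ‖p.2‖ ≤ ‖p‖ := norm_snd_le p
        have h3 := norm_nonneg p.1
        have h4 := norm_nonneg p.2
        rw [he]; nlinarith)
      (fun x => by
        obtain ⟨p, rfl⟩ := e.surjective x
        rw [LinearEquiv.symm_apply_apply, one_mul, Prod.norm_def]
        refine max_le ?_ ?_
        · refine abs_le_of_sq_le_sq' ?_ (norm_nonneg _) |>.2
          rw [he]; nlinarith [sq_nonneg ‖p.2‖]
        · refine abs_le_of_sq_le_sq' ?_ (norm_nonneg _) |>.2
          rw [he]; nlinarith [sq_nonneg ‖p.1‖])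
  exact (completeSpace_congr (e := e.toEquiv) E.isUniformEmbedding).1 inferInstance

/-- The topology on `K` given by the norm of the Hilbert space `|K|_J`. -/
@[reducible] def topology : TopologicalSpace K := inferInstanceAs (TopologicalSpace D.HilbertSpace)

/-- The fundamental symmetry is an isometry of the Hilbert space `|K|_J`. -/
def symmetryHilbert : D.HilbertSpace →L[ℂ] D.HilbertSpace :=
  (D.equiv.toLinearMap ∘ₗ D.symmetryₗ ∘ₗ D.equiv.symm.toLinearMap).mkContinuous 1 fun x => by
    obtain ⟨x, rfl⟩ := D.equiv.surjective x
    refine (abs_le_of_sq_le_sq' ?_ (by positivity)).2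
    rw [LinearMap.comp_apply, LinearMap.comp_apply, LinearEquiv.coe_coe, LinearEquiv.coe_coe,
      LinearEquiv.symm_apply_apply, one_mul, @norm_sq_eq_re_inner ℂ, @norm_sq_eq_re_inner ℂ,
      inner_equiv, inner_equiv, symmetryₗ_symmetryₗ]
    exact (congrArg Complex.re (D.form_symmetryₗ_left x x)).le

theorem symmetryHilbert_equiv (x : K) :
    D.symmetryHilbert (D.equiv x) = D.equiv (D.symmetryₗ x) := rfl

theorem form_eq_inner (x y : K) :
    B x y = inner ℂ (D.equiv x) (D.symmetryHilbert (D.equiv y)) := by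
  rw [symmetryHilbert_equiv, inner_equiv, symmetryₗ_symmetryₗ]

theorem eq_zero_of_form (D : FundamentalDecomposition B) {y : K} (h : ∀ z, B z y = 0) : y = 0 := by
  have := h (D.symmetryₗ y)
  rw [form_symmetryₗ_left] at this
  exact D.core.definite y this

theorem continuous_form (z : K) : Continuous fun v : D.HilbertSpace => B z (D.equiv.symm v) := by
  have : Continuous fun v : D.HilbertSpace => inner ℂ (D.equiv z) (D.symmetryHilbert v) := by
    fun_prop
  refine this.congr fun v => ?_
  rw [form_eq_inner D, LinearEquiv.apply_symm_apply]

/-- The identity map between the Hilbert spaces of two fundamental decompositions is continuous. -/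
theorem continuous_equiv (D' : FundamentalDecomposition B) :
    Continuous (D.equiv.symm.trans D'.equiv) := by
  refine LinearMap.continuous_of_seq_closed_graph
    (g := (D.equiv.symm.trans D'.equiv).toLinearMap) fun u x y hu hy => ?_
  have h1 := fun z => ((D.continuous_form z).tendsto x).comp hu
  have h2 := fun z => ((D'.continuous_form z).tendsto y).comp hy
  have h3 : D'.equiv.symm y - D.equiv.symm x = 0 := D.eq_zero_of_form fun z => by
    rw [map_sub, sub_eq_zero]
    exact tendsto_nhds_unique (h2 z) (h1 z)
  exact (LinearEquiv.symm_apply_eq _).1 (sub_eq_zero.1 h3)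

/-- All fundamental decompositions induce the same topology. -/
theorem topology_eq (D' : FundamentalDecomposition B) : D.topology = D'.topology :=
  le_antisymm (continuous_id_iff_le.1 (D.continuous_equiv D'))
    (continuous_id_iff_le.1 (D'.continuous_equiv D))

end FundamentalDecomposition

/-- A complex Krein space, equipped with its strong topology. The last field says that the form
admits a fundamental decomposition and that the given topology is the one induced by the norm of
the associated Hilbert space; by `FundamentalDecomposition.topology_eq` this topology does not
depend on the decomposition. -/
class KreinSpace (K : Type*) [AddCommGroup K] [Module ℂ K] [t : TopologicalSpace K] where
  form : K →ₗ⋆[ℂ] K →ₗ[ℂ] ℂ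
  form_hermitian : ∀ x y, conj (form x y) = form y x
  exists_decomposition : ∃ D : FundamentalDecomposition form, t = D.topology

namespace KreinSpace

variable {K : Type*} [AddCommGroup K] [Module ℂ K] [t : TopologicalSpace K] [KreinSpace K]

theorem topology_eq (D : FundamentalDecomposition (form (K := K))) : t = D.topology := by
  obtain ⟨D₀, h₀⟩ := exists_decomposition (K := K)
  exact h₀.trans (D₀.topology_eq D)

/-- The identity map of a Krein space, as a homeomorphism onto the Hilbert space `|K|_J`. -/
def toHilbert (D : FundamentalDecomposition (form (K := K))) : K ≃L[ℂ] D.HilbertSpace where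
  toLinearEquiv := D.equiv
  continuous_toFun := continuous_id_iff_le.2 (topology_eq D).le
  continuous_invFun := continuous_id_iff_le.2 (topology_eq D).ge

instance : IsTopologicalAddGroup K := by
  obtain ⟨D, -⟩ := exists_decomposition (K := K)
  exact (toHilbert D).toHomeomorph.isInducing.topologicalAddGroup
    (toHilbert D).toLinearEquiv.toAddEquiv

instance : ContinuousSMul ℂ K := by
  obtain ⟨D, -⟩ := exists_decomposition (K := K)
  exact (toHilbert D).toHomeomorph.isInducing.continuousSMul continuous_id
    (fun {c x} => (toHilbert D).map_smul c x)

/-- The fundamental symmetry of a fundamental decomposition as a continuous operator on `K`. -/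
def symmetry (D : FundamentalDecomposition (form (K := K))) : K →L[ℂ] K :=
  (toHilbert D).symm.toContinuousLinearMap ∘L D.symmetryHilbert ∘L
    (toHilbert D).toContinuousLinearMap

theorem symmetry_apply (D : FundamentalDecomposition (form (K := K))) (x : K) :
    symmetry D x = D.projPos x - D.projNeg x := rfl

theorem ext_form_left {x y : K} (h : ∀ z, form x z = form y z) : x = y := by
  obtain ⟨D, -⟩ := exists_decomposition (K := K)
  rw [← sub_eq_zero]
  refine D.eq_zero_of_form fun z => ?_
  rw [map_sub, sub_eq_zero, ← form_hermitian x z, ← form_hermitian y z, h]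

/-- Every continuous operator on a Krein space has a continuous adjoint for the form. -/
theorem exists_adjoint (T : K →L[ℂ] K) :
    ∃ S : K →L[ℂ] K, ∀ x y, form (S x) y = form x (T y) := by
  obtain ⟨D, -⟩ := exists_decomposition (K := K)
  let e := toHilbert D
  let T' : D.HilbertSpace →L[ℂ] D.HilbertSpace :=
    e.toContinuousLinearMap ∘L T ∘L e.symm.toContinuousLinearMap
  let S' : D.HilbertSpace →L[ℂ] D.HilbertSpace :=
    D.symmetryHilbert ∘L ContinuousLinearMap.adjoint T' ∘L D.symmetryHilbert
  refine ⟨e.symm.toContinuousLinearMap ∘L S' ∘L e.toContinuousLinearMap, fun x y => ?_⟩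
  have h := ContinuousLinearMap.adjoint_inner_left T' (D.equiv y) (D.equiv (D.symmetryₗ x))
  obtain ⟨w, hw⟩ := D.equiv.surjective (ContinuousLinearMap.adjoint T' (D.equiv (D.symmetryₗ x)))
  have hT : T' (D.equiv y) = D.equiv (T y) := rfl
  rw [hT, ← hw, D.inner_equiv, D.inner_equiv, ← D.form_symmetryₗ_left, ← D.form_symmetryₗ_left,
    D.symmetryₗ_symmetryₗ] at h
  have hS : (e.symm.toContinuousLinearMap ∘L S' ∘L e.toContinuousLinearMap) x = D.symmetryₗ w :=
    congrArg (fun v => D.equiv.symm (D.symmetryHilbert v)) hw.symm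
  rw [hS]
  exact h

/-- The involution on the algebra of continuous operators is the Krein space adjoint. -/
instance : Star (K →L[ℂ] K) where
  star T := Classical.choose (exists_adjoint T)

theorem form_star_left (T : K →L[ℂ] K) (x y : K) : form (star T x) y = form x (T y) :=
  Classical.choose_spec (exists_adjoint T) x y

theorem form_star_right (T : K →L[ℂ] K) (x y : K) : form x (star T y) = form (T x) y := by
  rw [← form_hermitian, form_star_left, form_hermitian]

instance : StarRing (K →L[ℂ] K) where
  star_involutive T := by
    ext x
    exact ext_form_left fun z => by rw [form_star_left, form_star_right]
  star_mul S T := by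
    ext x
    exact ext_form_left fun z => by
      simp only [form_star_left, _root_.mul_apply_eq_comp]
  star_add S T := by
    ext x
    exact ext_form_left fun z => by
      simp only [form_star_left, _root_.add_apply, map_add, LinearMap.add_apply]

instance : StarModule ℂ (K →L[ℂ] K) where
  star_smul c T := by
    ext x
    exact ext_form_left fun z => by
      simp [form_star_left]

end KreinSpace

/-! ### Krein C*-algebras -/

/-- The algebra norm `p` is complete. -/
def AlgebraNorm.IsComplete {A : Type*} [Ring A] [Algebra ℂ A] (p : AlgebraNorm ℂ A) : Prop :=
  @CompleteSpace A p.toRingNorm.toNormedRing.toMetricSpace.toUniformSpace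

/-- A fundamental symmetry of a complex `*`-algebra: an involutive `*`-automorphism `α` such that
`‖α(x*)x‖ = ‖x‖²` for some norm making the algebra a Banach algebra. -/
def IsKreinFundamentalSymmetry {A : Type*} [Ring A] [StarRing A] [Algebra ℂ A]
    (α : A ≃⋆ₐ[ℂ] A) : Prop :=
  (∀ x, α (α x) = x) ∧
    ∃ p : AlgebraNorm ℂ A, p.IsComplete ∧ ∀ x, p (α (star x) * x) = p x ^ 2

/-- A unital Krein C*-algebra: a unital complex `*`-algebra that admits a fundamental symmetry. -/
class IsKreinCStarAlgebra (A : Type*) [Ring A] [StarRing A] [Algebra ℂ A] [StarModule ℂ A] :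
    Prop where
  exists_fundamentalSymmetry : ∃ α : A ≃⋆ₐ[ℂ] A, IsKreinFundamentalSymmetry α

end

/-!
A fundamental symmetry `α` turns `A` into a C⋆-algebra for the involution `x ↦ α (star x)`, and `α`
is a `*`-automorphism of it. By Gelfand–Naimark this C⋆-algebra acts faithfully on a Hilbert space
`H`, say by `ρ`; then `ρ ⊕ ρ ∘ α` acts on `H ⊕ H`, and the exchange `J` of the two summands
implements `α`. On the Krein space `H ⊕ H` with the form `(x, y) ↦ ⟪x, J y⟫` the adjoint of `T` is
`J T⋆ J`, so passing from the Hilbert space adjoint to the Krein adjoint undoes the twist of the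
involution. The range is closed because injective `*`-homomorphisms of C⋆-algebras are isometric.
-/

noncomputable section

open scoped InnerProductSpace

section GelfandNaimark

open scoped ComplexOrder ComplexStarModule

theorem exists_positiveLinearMap_eq_of_isSelfAdjoint {A : Type*} [NonUnitalRing A] [StarRing A]
    [Module ℂ A] [StarModule ℂ A] [PartialOrder A] [StarOrderedRing A] (g : A →ₗ[ℝ] ℝ)
    (hg : ∀ a, 0 ≤ a → 0 ≤ g a) :
    ∃ f : A →ₚ[ℂ] ℂ, ∀ a, IsSelfAdjoint a → f a = g a := by
  let f : A →ₗ[ℂ] ℂ := Module.Dual.extendRCLike (g ∘ₗ (selfAdjoint.submodule ℝ A).subtype ∘ₗ ℜ)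
  have hf (a : A) (ha : IsSelfAdjoint a) : f a = g a := by
    have hcomp (b : A) : (g ∘ₗ (selfAdjoint.submodule ℝ A).subtype ∘ₗ ℜ) b = g (ℜ b) := rfl
    simp [f, Module.Dual.extendRCLike_apply, hcomp, ha.coe_realPart, ha.imaginaryPart]
  refine ⟨.mk₀ f fun a ha => ?_, hf⟩
  rw [hf a (.of_nonneg ha)]
  exact_mod_cast hg a ha

variable {A : Type*}

theorem exists_positiveLinearMap_neg_of_not_nonneg [NonUnitalCStarAlgebra A] [PartialOrder A]
    [StarOrderedRing A] {a : A} (ha : IsSelfAdjoint a) (hneg : ¬ 0 ≤ a) :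
    ∃ f : A →ₚ[ℂ] ℂ, f a < 0 := by
  obtain ⟨g, hg, hga⟩ := (ProperCone.positive ℝ A).hyperplane_separation_point hneg
  obtain ⟨f, hf⟩ := exists_positiveLinearMap_eq_of_isSelfAdjoint (g : A →ₗ[ℝ] ℝ) hg
  exact ⟨f, by rw [hf a ha]; exact_mod_cast hga⟩

theorem exists_positiveLinearMap_star_mul_self_ne_zero [NonUnitalCStarAlgebra A] [PartialOrder A]
    [StarOrderedRing A] {a : A} (ha : a ≠ 0) : ∃ f : A →ₚ[ℂ] ℂ, f (star a * a) ≠ 0 := by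
  have hneg : ¬ 0 ≤ -(star a * a) := fun h => ha <| (CStarRing.star_mul_self_eq_zero_iff a).1 <|
    (neg_nonneg.1 h).antisymm (star_mul_self_nonneg a)
  obtain ⟨f, hf⟩ :=
    exists_positiveLinearMap_neg_of_not_nonneg (IsSelfAdjoint.star_mul_self a).neg hneg
  exact ⟨f, fun h => by simp [h] at hf⟩

theorem map_star_mul_self_eq_zero_of_gnsStarAlgHom_eq_zero [CStarAlgebra A] [PartialOrder A]
    [StarOrderedRing A] {f : A →ₚ[ℂ] ℂ} {a : A} (h : f.gnsStarAlgHom a = 0) :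
    f (star a * a) = 0 := by
  have hcyclic : ((f.toPreGNS a : f.PreGNS) : f.GNS) = 0 := by
    simpa using congr($h (f.toPreGNS 1 : f.GNS))
  have hnorm : ‖f.toPreGNS a‖ = 0 := by
    rw [← UniformSpace.Completion.norm_coe, hcyclic, norm_zero]
  simpa [hnorm] using (f.preGNS_norm_sq (f.toPreGNS a)).symm

section DirectSum

variable [CStarAlgebra A] {ι : Type*} {H : ι → Type*} [∀ i, NormedAddCommGroup (H i)]
  [∀ i, InnerProductSpace ℂ (H i)] [∀ i, CompleteSpace (H i)]

/-- The direct sum of a family of representations of a C⋆-algebra, acting diagonally on the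
Hilbert sum of the underlying spaces. It is bounded because each `ρ i` is contractive. -/
def directSumRepresentation (ρ : ∀ i, A →⋆ₐ[ℂ] (H i →L[ℂ] H i)) :
    A →⋆ₐ[ℂ] (lp H 2 →L[ℂ] lp H 2) where
  toFun a := lp.mapCLM 2 (fun i => ρ i a) (norm_nonneg a) fun i =>
    NonUnitalStarAlgHom.norm_apply_le (ρ i) a
  map_one' := by ext; simp
  map_mul' _ _ := by ext; simp
  map_zero' := by ext; simp
  map_add' _ _ := by ext; simp
  commutes' _ := by ext; simp [Algebra.algebraMap_eq_smul_one]
  map_star' a := (ContinuousLinearMap.eq_adjoint_iff _ _).2 fun x y => by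
    simp only [lp.inner_eq_tsum, lp.mapCLM_apply_coe, map_star,
      ContinuousLinearMap.star_eq_adjoint, ContinuousLinearMap.adjoint_inner_left]

@[simp]
theorem directSumRepresentation_apply_coe (ρ : ∀ i, A →⋆ₐ[ℂ] (H i →L[ℂ] H i)) (a : A)
    (x : lp H 2) (i : ι) : directSumRepresentation ρ a x i = ρ i a (x i) := rfl

theorem directSumRepresentation_eq_zero_iff {ρ : ∀ i, A →⋆ₐ[ℂ] (H i →L[ℂ] H i)} {a : A} :
    directSumRepresentation ρ a = 0 ↔ ∀ i, ρ i a = 0 := by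
  classical
  refine ⟨fun h i => ContinuousLinearMap.ext fun v => ?_, fun h => by ext; simp [h]⟩
  simpa using congr($h (lp.single 2 i v) i)

end DirectSum

/-- The **Gelfand–Naimark theorem**. -/
theorem exists_injective_starAlgHom_hilbertSpace (A : Type u) [CStarAlgebra A] :
    ∃ (H : Type u) (_ : NormedAddCommGroup H) (_ : InnerProductSpace ℂ H) (_ : CompleteSpace H)
      (ρ : A →⋆ₐ[ℂ] (H →L[ℂ] H)), Function.Injective ρ := by
  let _ : PartialOrder A := CStarAlgebra.spectralOrder A
  have _ : StarOrderedRing A := CStarAlgebra.spectralOrderedRing A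
  refine ⟨lp (fun f : A →ₚ[ℂ] ℂ => f.GNS) 2, inferInstance, inferInstance, inferInstance,
    directSumRepresentation fun f => f.gnsStarAlgHom, ?_⟩
  refine (injective_iff_map_eq_zero _).2 fun a ha => of_not_not fun hne => ?_
  obtain ⟨f, hf⟩ := exists_positiveLinearMap_star_mul_self_ne_zero hne
  exact hf (map_star_mul_self_eq_zero_of_gnsStarAlgHom_eq_zero
    (directSumRepresentation_eq_zero_iff.1 ha f))

end GelfandNaimark

/-- Self-adjoint unitaries. For an operator on a Hilbert space this says that it is the reflection
`x₊ + x₋ ↦ x₊ - x₋` of some orthogonal decomposition. -/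
structure IsSelfAdjointInvolution {R : Type*} [MulOneClass R] [Star R] (J : R) : Prop where
  isSelfAdjoint : IsSelfAdjoint J
  mul_self : J * J = 1

section Doubling

variable (H : Type*) [NormedAddCommGroup H] [InnerProductSpace ℂ H]

/-- The operator on `H ⊕ H` that exchanges the two summands. -/
def swapSummands : lp (fun _ : Bool => H) 2 →L[ℂ] lp (fun _ : Bool => H) 2 :=
  ((lpPiLpₗᵢ _ ℂ).trans
    ((LinearIsometryEquiv.piLpCongrLeft 2 ℂ H Equiv.boolNot).trans (lpPiLpₗᵢ _ ℂ).symm) :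
      lp (fun _ : Bool => H) 2 ≃ₗᵢ[ℂ] lp (fun _ : Bool => H) 2)

variable {H}

@[simp]
theorem swapSummands_apply_coe (x : lp (fun _ : Bool => H) 2) (b : Bool) :
    swapSummands H x b = x (!b) := rfl

variable [CompleteSpace H]

theorem isSelfAdjointInvolution_swapSummands : IsSelfAdjointInvolution (swapSummands H) where
  isSelfAdjoint := by
    refine ((ContinuousLinearMap.eq_adjoint_iff _ _).2 fun x y => ?_).symm
    simp [lp.inner_eq_tsum, tsum_fintype, add_comm]
  mul_self := by ext; simp

theorem exists_covariant_injective_starAlgHom {B : Type u} [CStarAlgebra B] (θ : B →⋆ₐ[ℂ] B)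
    (hθ : Function.Involutive θ) :
    ∃ (H : Type u) (_ : NormedAddCommGroup H) (_ : InnerProductSpace ℂ H) (_ : CompleteSpace H)
      (J : H →L[ℂ] H) (ρ : B →⋆ₐ[ℂ] (H →L[ℂ] H)),
      IsSelfAdjointInvolution J ∧ Function.Injective ρ ∧ ∀ b, ρ (θ b) = J * ρ b * J := by
  obtain ⟨H, _, _, _, ρ, hρ⟩ := exists_injective_starAlgHom_hilbertSpace B
  let σ := directSumRepresentation (H := fun _ : Bool => H) fun i => bif i then ρ.comp θ else ρ
  refine ⟨_, _, _, inferInstance, swapSummands H, σ, isSelfAdjointInvolution_swapSummands, ?_, ?_⟩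
  · refine (injective_iff_map_eq_zero σ).2 fun b hb => (injective_iff_map_eq_zero ρ).1 hρ b ?_
    exact directSumRepresentation_eq_zero_iff.1 hb false
  · intro b
    ext x (_ | _) <;> simp [σ, hθ b]

end Doubling

section KreinSpaceOfInvolution

theorem isCompl_eigenspace_one_eigenspace_neg_one {R M : Type*} [CommRing R] [Invertible (2 : R)]
    [AddCommGroup M] [Module R M] {f : Module.End R M} (hf : f * f = 1) :
    IsCompl (f.eigenspace 1) (f.eigenspace (-1)) := by
  have hinv (x : M) : f (f x) = x := congr($hf x)
  have half_add_half (x : M) : (⅟2 : R) • x + (⅟2 : R) • x = x := by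
    rw [← two_smul R, smul_smul, mul_invOf_self, one_smul]
  refine IsCompl.of_eq ((Submodule.eq_bot_iff _).2 fun x ⟨hx, hx'⟩ => ?_)
    (Submodule.eq_top_iff'.2 fun x => Submodule.mem_sup.2
      ⟨(⅟2 : R) • (x + f x), ?_, (⅟2 : R) • (x - f x), ?_, ?_⟩)
  · rw [SetLike.mem_coe, Module.End.mem_eigenspace_iff] at hx hx'
    have hneg : x = -x := by simpa using hx.symm.trans hx'
    rw [← half_add_half x, ← smul_add, add_eq_zero_iff_eq_neg.2 hneg, smul_zero]
  · simp [hinv, add_comm]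
  · simp [hinv]
  · rw [← smul_add, add_add_sub_cancel, smul_add, half_add_half]

theorem isClosed_eigenspace {R E : Type*} [CommRing R] [AddCommGroup E] [Module R E]
    [TopologicalSpace E] [T2Space E] [ContinuousConstSMul R E] (T : E →L[R] E) (μ : R) :
    IsClosed (Module.End.eigenspace (T : E →ₗ[R] E) μ : Set E) := by
  convert isClosed_eq T.continuous (continuous_const_smul μ) using 1
  ext x
  simp

theorem uniformSpace_eq_of_core_inner_eq {𝕜 V : Type*} [RCLike 𝕜] [n : NormedAddCommGroup V]
    [InnerProductSpace 𝕜 V] (c : InnerProductSpace.Core 𝕜 V)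
    (hc : ∀ x y, c.inner x y = ⟪x, y⟫_𝕜) :
    c.toNormedAddCommGroup.toMetricSpace.toUniformSpace = n.toMetricSpace.toUniformSpace := by
  have hnorm (x : V) : @norm V c.toNormedAddCommGroup.toNorm x = ‖x‖ :=
    congr(√(RCLike.re $(hc x x))).trans (norm_eq_sqrt_re_inner x).symm
  refine congrArg (@PseudoMetricSpace.toUniformSpace V) (PseudoMetricSpace.ext (Dist.ext ?_))
  funext x y
  rw [@NormedAddCommGroup.dist_eq V c.toNormedAddCommGroup, @NormedAddCommGroup.dist_eq V n]
  exact hnorm _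

theorem isHilbertForm_of_eq_inner {V : Type*} [NormedAddCommGroup V] [InnerProductSpace ℂ V]
    [hV : CompleteSpace V] {B : V →ₗ⋆[ℂ] V →ₗ[ℂ] ℂ} (hB : ∀ x y, B x y = ⟪x, y⟫_ℂ) :
    IsHilbertForm B := by
  refine ⟨InnerProductSpace.toCore, fun x y => (hB x y).symm, ?_⟩
  rwa [uniformSpace_eq_of_core_inner_eq _ fun _ _ => rfl]

variable {H : Type*} [NormedAddCommGroup H] [InnerProductSpace ℂ H]

theorem isHilbertForm_domRestrict₁₂ [CompleteSpace H] {B : H →ₗ⋆[ℂ] H →ₗ[ℂ] ℂ} {S : Submodule ℂ H}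
    (hS : IsClosed (S : Set H)) (hB : ∀ x ∈ S, ∀ y ∈ S, B x y = ⟪x, y⟫_ℂ) :
    IsHilbertForm (B.domRestrict₁₂ S S) :=
  have := hS.completeSpace_coe
  isHilbertForm_of_eq_inner fun x y => hB x x.2 y y.2

/-- The sesquilinear form `(x, y) ↦ ⟪x, J y⟫`, which is indefinite when `J` is a self-adjoint
involution other than `±1`. -/
def twistedInner (J : H →L[ℂ] H) : H →ₗ⋆[ℂ] H →ₗ[ℂ] ℂ := (innerₛₗ ℂ).compl₂ (J : H →ₗ[ℂ] H)

@[simp]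
theorem twistedInner_apply (J : H →L[ℂ] H) (x y : H) : twistedInner J x y = ⟪x, J y⟫_ℂ := rfl

variable [CompleteSpace H] {J : H →L[ℂ] H}

theorem conj_twistedInner (hJ : IsSelfAdjoint J) (x y : H) :
    conj (twistedInner J x y) = twistedInner J y x := by
  simp [hJ.isSymmetric.apply_clm]

namespace IsSelfAdjointInvolution

theorem apply_apply (hJ : IsSelfAdjointInvolution J) (x : H) : J (J x) = x := congr($hJ.mul_self x)

theorem inner_eq_zero (hJ : IsSelfAdjointInvolution J) {x y : H} (hx : J x = x) (hy : J y = -y) :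
    ⟪x, y⟫_ℂ = 0 := by
  have h := hJ.isSelfAdjoint.isSymmetric.apply_clm x y
  rwa [hx, hy, inner_neg_right, self_eq_neg] at h

/-- The decomposition of a Hilbert space into the eigenspaces of a self-adjoint involution `J`, as a
fundamental decomposition for the form `(x, y) ↦ ⟪x, J y⟫`. -/
def decomposition (hJ : IsSelfAdjointInvolution J) :
    FundamentalDecomposition (twistedInner J) where
  pos := Module.End.eigenspace (J : H →ₗ[ℂ] H) 1
  neg := Module.End.eigenspace (J : H →ₗ[ℂ] H) (-1)
  isCompl := isCompl_eigenspace_one_eigenspace_neg_one congr(($hJ.mul_self : H →ₗ[ℂ] H))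
  orthogonal x hx y hy := by
    have hx : J x = x := by simpa using hx
    have hy : J y = -y := by simpa using hy
    have hxy := hJ.inner_eq_zero hx hy
    simp [hx, hy, hxy, inner_eq_zero_symm.1 hxy]
  pos_hilbert := isHilbertForm_domRestrict₁₂ (isClosed_eigenspace J 1) fun x _ y hy => by
    have hy : J y = y := by simpa using hy
    simp [hy]
  neg_hilbert := isHilbertForm_domRestrict₁₂ (isClosed_eigenspace J (-1)) fun x _ y hy => by
    have hy : J y = -y := by simpa using hy
    simp [hy]

theorem symmetryₗ_decomposition (hJ : IsSelfAdjointInvolution J) (x : H) :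
    hJ.decomposition.symmetryₗ x = J x := by
  have hpos : J (hJ.decomposition.projPos x) = hJ.decomposition.projPos x := by
    simpa [decomposition] using hJ.decomposition.projPos_mem x
  have hneg : J (hJ.decomposition.projNeg x) = -hJ.decomposition.projNeg x := by
    simpa [decomposition] using hJ.decomposition.projNeg_mem x
  conv_rhs => rw [← hJ.decomposition.projPos_add_projNeg x]
  rw [map_add, hpos, hneg, ← sub_eq_add_neg, FundamentalDecomposition.symmetryₗ_apply]

theorem topology_decomposition (hJ : IsSelfAdjointInvolution J) :
    hJ.decomposition.topology = (inferInstance : TopologicalSpace H) :=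
  congrArg (@UniformSpace.toTopologicalSpace H) <|
    uniformSpace_eq_of_core_inner_eq hJ.decomposition.core fun x y => by
      change ⟪x, J (hJ.decomposition.symmetryₗ y)⟫_ℂ = _
      rw [symmetryₗ_decomposition, hJ.apply_apply]

end IsSelfAdjointInvolution

/-- A Hilbert space `H` with a self-adjoint involution `J`, regarded as a Krein space with the form
`(x, y) ↦ ⟪x, J y⟫`. The synonym separates the Krein adjoint from the Hilbert space adjoint. -/
def KreinOf (_ : IsSelfAdjointInvolution J) : Type _ := H

namespace KreinOf

variable (hJ : IsSelfAdjointInvolution J)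

instance : AddCommGroup (KreinOf hJ) := inferInstanceAs (AddCommGroup H)
instance : Module ℂ (KreinOf hJ) := inferInstanceAs (Module ℂ H)
instance : TopologicalSpace (KreinOf hJ) := inferInstanceAs (TopologicalSpace H)

instance : KreinSpace (KreinOf hJ) where
  form := twistedInner (H := H) J
  form_hermitian := conj_twistedInner (H := H) hJ.isSelfAdjoint
  exists_decomposition := ⟨hJ.decomposition, hJ.topology_decomposition.symm⟩

/-- The identity map from the Hilbert space `H` to the associated Krein space. -/
def equiv : H ≃L[ℂ] KreinOf hJ := ContinuousLinearEquiv.refl ℂ H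

theorem form_equiv (x y : H) :
    KreinSpace.form (equiv hJ x) (equiv hJ y) = ⟪x, J y⟫_ℂ := rfl

/-- The fundamental decomposition of the Krein space into the eigenspaces of `J`. -/
def decomposition : FundamentalDecomposition (KreinSpace.form (K := KreinOf hJ)) :=
  hJ.decomposition

/-- The identification of the operators on `H` with those on the associated Krein space. It does
not preserve the involutions, see `KreinOf.star_mapOperator`. -/
def mapOperator : (H →L[ℂ] H) ≃A[ℂ] (KreinOf hJ →L[ℂ] KreinOf hJ) :=
  (equiv hJ).conjContinuousAlgEquiv

theorem mapOperator_apply (T : H →L[ℂ] H) (x : H) :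
    mapOperator hJ T (equiv hJ x) = equiv hJ (T x) := rfl

theorem symmetry_decomposition : KreinSpace.symmetry (decomposition hJ) = mapOperator hJ J :=
  ContinuousLinearMap.ext hJ.symmetryₗ_decomposition

theorem star_mapOperator (T : H →L[ℂ] H) :
    star (mapOperator hJ T) = mapOperator hJ (J * star T * J) := by
  ext x
  refine KreinSpace.ext_form_left fun y => ?_
  obtain ⟨x, rfl⟩ := (equiv hJ).surjective x
  obtain ⟨y, rfl⟩ := (equiv hJ).surjective y
  rw [KreinSpace.form_star_left, mapOperator_apply, mapOperator_apply, form_equiv, form_equiv]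
  simp [ContinuousLinearMap.star_eq_adjoint, ContinuousLinearMap.adjoint_inner_left,
    hJ.isSelfAdjoint.isSymmetric.apply_clm, hJ.apply_apply]

/-- An algebra homomorphism into the operators on `H` that intertwines the involution with
`T ↦ J T⋆ J`, as a representation on the associated Krein space. -/
def starAlgHom {A : Type*} [Ring A] [StarRing A] [Algebra ℂ A] (φ : A →ₐ[ℂ] (H →L[ℂ] H))
    (hφ : ∀ a, φ (star a) = J * star (φ a) * J) : A →⋆ₐ[ℂ] (KreinOf hJ →L[ℂ] KreinOf hJ) where
  __ := (mapOperator hJ : (H →L[ℂ] H) →ₐ[ℂ] (KreinOf hJ →L[ℂ] KreinOf hJ)).comp φ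
  map_star' a := (congrArg (mapOperator hJ) (hφ a)).trans (star_mapOperator hJ (φ a)).symm

theorem starAlgHom_apply {A : Type*} [Ring A] [StarRing A] [Algebra ℂ A]
    (φ : A →ₐ[ℂ] (H →L[ℂ] H)) (hφ : ∀ a, φ (star a) = J * star (φ a) * J) (a : A) :
    starAlgHom hJ φ hφ a = mapOperator hJ (φ a) := rfl

end KreinOf

end KreinSpaceOfInvolution

namespace IsKreinFundamentalSymmetry

variable {A : Type u} [Ring A] [StarRing A] [Algebra ℂ A] {α : A ≃⋆ₐ[ℂ] A}

theorem apply_apply (hα : IsKreinFundamentalSymmetry α) (x : A) : α (α x) = x := hα.1 x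

/-- The algebra `A` with the involution `x ↦ α (star x)`, which is a C⋆-algebra for a norm as in
the definition of a fundamental symmetry `α`. -/
def Twist (_ : IsKreinFundamentalSymmetry α) : Type u := A

/-- A complete submultiplicative norm with `‖α (star x) * x‖ = ‖x‖ ^ 2`. -/
def algebraNorm (hα : IsKreinFundamentalSymmetry α) : AlgebraNorm ℂ A := Classical.choose hα.2

theorem isComplete_algebraNorm (hα : IsKreinFundamentalSymmetry α) : hα.algebraNorm.IsComplete :=
  (Classical.choose_spec hα.2).1

theorem algebraNorm_apply_star_mul_self (hα : IsKreinFundamentalSymmetry α) (x : A) :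
    hα.algebraNorm (α (star x) * x) = hα.algebraNorm x ^ 2 :=
  (Classical.choose_spec hα.2).2 x

variable [StarModule ℂ A] (hα : IsKreinFundamentalSymmetry α)

instance : CStarAlgebra hα.Twist where
  __ : NormedRing A := hα.algebraNorm.toRingNorm.toNormedRing
  __ : Algebra ℂ A := inferInstance
  norm_smul_le c x := (hα.algebraNorm.toSeminorm.smul' c x).le
  complete := hα.isComplete_algebraNorm.complete
  star (x : A) := α (star x)
  star_involutive (x : A) := by
    change α (star (α (star x))) = x
    rw [← map_star, star_star, hα.apply_apply]
  star_mul (x y : A) := by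
    change α (star (x * y)) = α (star y) * α (star x)
    rw [star_mul, map_mul]
  star_add (x y : A) := by
    change α (star (x + y)) = α (star x) + α (star y)
    rw [star_add, map_add]
  star_smul c (x : A) := by
    change α (star (c • x)) = star c • α (star x)
    rw [star_smul, map_smul]
  norm_mul_self_le (x : A) := by
    change hα.algebraNorm x * hα.algebraNorm x ≤ hα.algebraNorm (α (star x) * x)
    rw [hα.algebraNorm_apply_star_mul_self, sq]

/-- The identity map from `A` to the twisted algebra. -/
def toTwist : A ≃ₐ[ℂ] hα.Twist := AlgEquiv.refl

theorem star_toTwist (x : A) : star (hα.toTwist x) = hα.toTwist (α (star x)) := rfl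

/-- The fundamental symmetry as an endomorphism of the twisted C⋆-algebra. -/
def twistSymmetry : hα.Twist →⋆ₐ[ℂ] hα.Twist where
  __ := hα.toTwist.toAlgHom.comp ((α : A →ₐ[ℂ] A).comp hα.toTwist.symm.toAlgHom)
  map_star' x := congrArg (hα.toTwist ∘ α) (map_star α (hα.toTwist.symm x))

theorem twistSymmetry_toTwist (x : A) : hα.twistSymmetry (hα.toTwist x) = hα.toTwist (α x) := rfl

theorem involutive_twistSymmetry : Function.Involutive hα.twistSymmetry := hα.apply_apply

end IsKreinFundamentalSymmetry

theorem IsKreinFundamentalSymmetry.exists_faithful_representation {A : Type u} [Ring A]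
    [StarRing A] [Algebra ℂ A] [StarModule ℂ A] {α : A ≃⋆ₐ[ℂ] A}
    (hα : IsKreinFundamentalSymmetry α) :
    ∃ (K : Type u) (_ : AddCommGroup K) (_ : Module ℂ K) (_ : TopologicalSpace K)
      (_ : KreinSpace K) (D : FundamentalDecomposition (KreinSpace.form (K := K)))
      (π : A →⋆ₐ[ℂ] (K →L[ℂ] K)), Function.Injective π ∧ IsClosed (Set.range π) ∧
      ∀ x, π (α x) = KreinSpace.symmetry D * π x * KreinSpace.symmetry D := by
  obtain ⟨H, _, _, _, J, ρ, hJ, hρ, hcov⟩ :=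
    exists_covariant_injective_starAlgHom hα.twistSymmetry hα.involutive_twistSymmetry
  let φ : A →ₐ[ℂ] (H →L[ℂ] H) := (ρ : hα.Twist →ₐ[ℂ] (H →L[ℂ] H)).comp hα.toTwist
  have hφ_symm (x : A) : φ (α x) = J * φ x * J :=
    (congrArg ρ (hα.twistSymmetry_toTwist x).symm).trans (hcov (hα.toTwist x))
  have hφ_star (x : A) : φ (star x) = J * star (φ x) * J := by
    have hstar : star (φ x) = φ (α (star x)) :=
      (map_star ρ (hα.toTwist x)).symm.trans (congrArg ρ (hα.star_toTwist x))
    rw [hstar, ← hφ_symm, hα.apply_apply]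
  have hφ_closed : IsClosed (Set.range φ) := by
    have := (NonUnitalStarAlgHom.isometry ρ hρ).isClosedEmbedding.isClosed_range
    rwa [← hα.toTwist.surjective.range_comp] at this
  let π := KreinOf.starAlgHom hJ φ hφ_star
  refine ⟨KreinOf hJ, inferInstance, inferInstance, inferInstance, inferInstance,
    KreinOf.decomposition hJ, π, ?_, ?_, fun x => ?_⟩
  · exact (KreinOf.mapOperator hJ).injective.comp (hρ.comp hα.toTwist.injective)
  · have := (KreinOf.mapOperator hJ).toHomeomorph.isClosedMap _ hφ_closed
    rwa [← Set.range_comp] at this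
  · rw [KreinOf.symmetry_decomposition, KreinOf.starAlgHom_apply, KreinOf.starAlgHom_apply,
      hφ_symm, map_mul, map_mul]

end

theorem mainTheorem1 {A : Type u} [Ring A] [StarRing A] [Algebra ℂ A] [StarModule ℂ A]
    [IsKreinCStarAlgebra A] :
    (∃ (K : Type u) (_ : AddCommGroup K) (_ : Module ℂ K) (_ : TopologicalSpace K)
      (_ : KreinSpace K) (π : A →⋆ₐ[ℂ] (K →L[ℂ] K)), Function.Injective π) ∧
    ∀ α : A ≃⋆ₐ[ℂ] A, IsKreinFundamentalSymmetry α →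
      ∃ (K : Type u) (_ : AddCommGroup K) (_ : Module ℂ K) (_ : TopologicalSpace K)
        (_ : KreinSpace K) (D : FundamentalDecomposition (KreinSpace.form (K := K)))
        (π : A →⋆ₐ[ℂ] (K →L[ℂ] K)) (S : StarSubalgebra ℂ (K →L[ℂ] K)) (e : A ≃⋆ₐ[ℂ] S),
        Function.Injective π ∧
        IsClosed (S : Set (K →L[ℂ] K)) ∧
        (∀ x, (e x : K →L[ℂ] K) = π x) ∧
        ∀ x, π (α x) = KreinSpace.symmetry D * π x * KreinSpace.symmetry D := by
  refine ⟨?_, fun α hα => ?_⟩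
  · obtain ⟨α, hα⟩ := IsKreinCStarAlgebra.exists_fundamentalSymmetry (A := A)
    obtain ⟨K, i₁, i₂, i₃, i₄, -, π, hπ, -⟩ := hα.exists_faithful_representation
    exact ⟨K, i₁, i₂, i₃, i₄, π, hπ⟩
  · obtain ⟨K, i₁, i₂, i₃, i₄, D, π, hπ, hclosed, hπα⟩ := hα.exists_faithful_representation
    exact ⟨K, i₁, i₂, i₃, i₄, D, π, π.range, .ofInjective π hπ, hπ, hclosed, fun _ => rfl, hπα⟩
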